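/- Let $(R,\mathfrak m,k)$ be a complete Noetherian local ring of dimension $d\ge 3$ with infinite residue field $k$, and write $\mu(\cdot)$ for the minimal number of generators. Let $J\subseteq\mathfrak m$ be a perfect ideal of $R$ of height $3$; that is, $R/J$ has finite projective dimension over $R$ and this projective dimension equals the grade of $J$ (the supremum of the lengths of the $R$-regular sequences contained in $J$). Assume that $\mu\big((J+\mathfrak m^2)/\mathfrak m^2\big)\ge 2$ and that $J\not\subseteq yR+\mathfrak m^2$ for every $y\in\mathfrak m$. Then $\mu(J)\le 3$. -/

import Mathlib

universe u

/-- The grade of an ideal `J` of a commutative ring `R`: the supremum of the lengths of the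
`R`-sequences contained in `J`. For a proper ideal `J` of a local ring, weakly regular sequences
in `J` are the same as regular ones; the grade of the unit ideal is `⊤`, as usual. -/
noncomputable def Ideal.rGrade {R : Type u} [CommRing R] (J : Ideal R) : ℕ∞ :=
  ⨆ (rs : List R) (_ : ∀ r ∈ rs, r ∈ J) (_ : RingTheory.Sequence.IsWeaklyRegular R rs),
    (rs.length : ℕ∞)

/-- An ideal `J` is perfect if `R ⧸ J` has finite projective dimension, equal to the grade
of `J`. -/
def Ideal.IsPerfectIdeal {R : Type u} [CommRing R] (J : Ideal R) : Prop :=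
  CategoryTheory.projectiveDimension (ModuleCat.of R (R ⧸ J)) ≠ ⊤ ∧
    CategoryTheory.projectiveDimension (ModuleCat.of R (R ⧸ J)) = (J.rGrade : WithBot ℕ∞)

/-!
The number of generators of `J` is bounded by factoring out elements of `J` until the quotient has
projective dimension at most one, in which case the ideal is free and hence principal
(`Ideal.spanFinrank_le_one_of_hasProjectiveDimensionLT_two`). Factoring out one element of `J` lowers
the minimal number of generators by at most one.

The grade of an ideal is bounded by its height (`Ideal.rGrade_le_height`), so a perfect ideal of
height three has projective dimension at most three. The projective dimension drops with each
factored element by Nagata's change of rings theorem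
(`hasProjectiveDimensionLT_quotient_span_singleton`), provided that the element is a nonzerodivisor
outside the square of the maximal ideal. Two such elements are needed.

The first, `x`, exists by prime avoidance, since `J` contains a nonzerodivisor and is not contained
in `𝔪²`. For the second, `J/(x)` contains a nonzerodivisor of `R/x` because the grade of `J` is at
least two (`Ideal.exists_mem_map_quotient_span_nonZeroDivisors`), and it is not contained in the
square of the maximal ideal of `R/x` because `J` is not contained in `(x) + 𝔪²`. So prime avoidance
applies again.

Nagata's theorem reduces by syzygies to modules of projective dimension at most one, where it is a
statement about a pair of matrices whose product is `x` times the identity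
(`exists_eq_smul_of_mem_of_smul_mem`).
-/

open IsLocalRing CategoryTheory

/-! ### Grade, height and prime avoidance -/

section Grade

variable {R : Type u} [CommRing R]

/-- The first two members of a long enough regular sequence; that the second one is regular modulo
the first is phrased through divisibility. -/
theorem Ideal.exists_pair_of_two_le_rGrade {J : Ideal R} (h : 2 ≤ J.rGrade) :
    ∃ a ∈ J, ∃ b ∈ J, a ∈ nonZeroDivisors R ∧ ∀ r, a ∣ b * r → a ∣ r := by
  have h1 : (1 : ℕ∞) < J.rGrade := lt_of_lt_of_le (by norm_num) h
  simp only [Ideal.rGrade, lt_iSup_iff] at h1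
  obtain ⟨rs, hrs, hreg, hlen⟩ := h1
  match rs, hlen with
  | [], hlen => simp at hlen
  | [_], hlen => simp at hlen
  | a :: b :: rs, _ =>
    rw [RingTheory.Sequence.isWeaklyRegular_cons_iff,
      RingTheory.Sequence.isWeaklyRegular_cons_iff] at hreg
    obtain ⟨ha, hb, -⟩ := hreg
    refine ⟨a, hrs a (by simp), b, hrs b (by simp), ?_, fun r hr => ?_⟩
    · exact mem_nonZeroDivisors_iff_right.2 fun z hz => ha (by simpa [mul_comm] using hz)
    · have hmem : ∀ t : R, (Submodule.Quotient.mk t : QuotSMulTop a R) = 0 ↔ a ∣ t := fun t => by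
        rw [Submodule.Quotient.mk_eq_zero, ← Submodule.ideal_span_singleton_smul, smul_eq_mul,
          Ideal.mul_top, Ideal.mem_span_singleton]
      refine (hmem r).1 (hb (Eq.trans ?_ (smul_zero b).symm))
      exact (hmem (b * r)).2 hr

variable [IsNoetherianRing R]

theorem Ideal.length_le_height_of_isWeaklyRegular {J : Ideal R} {rs : List R}
    (hrs : ∀ r ∈ rs, r ∈ J) (hreg : RingTheory.Sequence.IsWeaklyRegular R rs) :
    (rs.length : ℕ∞) ≤ J.height := by
  rw [Ideal.height_eq_inf_minimalPrimes]
  refine le_iInf₂ fun p hp => ?_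
  have : p.IsPrime := hp.isPrime
  -- Localizing at a minimal prime `p` of `J`, the sequence cuts the dimension of `R_p`, which is
  -- the height of `p`, by its length.
  have hR := hreg.isRegular_of_isLocalization_of_mem (Localization.AtPrime p) p
    fun r hr => hp.1.2 (hrs r hr)
  have h := ringKrullDim_add_length_eq_ringKrullDim_of_isRegular _ hR
  rw [IsLocalization.AtPrime.ringKrullDim_eq_height p (Localization.AtPrime p)] at h
  have h0 : 0 ≤ ringKrullDim (Localization.AtPrime p ⧸
      Ideal.ofList (rs.map (algebraMap R (Localization.AtPrime p)))) := by
    have : Nontrivial (Localization.AtPrime p ⧸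
        Ideal.ofList (rs.map (algebraMap R (Localization.AtPrime p)))) :=
      Ideal.Quotient.nontrivial_iff.2 (by simpa using hR.top_ne_smul.symm)
    exact ringKrullDim_nonneg_of_nontrivial
  rw [List.length_map] at h
  rw [← WithBot.coe_le_coe, ← h]
  exact le_add_of_nonneg_left h0

theorem Ideal.rGrade_le_height (J : Ideal R) : J.rGrade ≤ J.height :=
  iSup_le fun _ => iSup₂_le fun hrs hreg => length_le_height_of_isWeaklyRegular hrs hreg

/-- Prime avoidance for the associated primes of `R` together with the ideal `I`, which need not be
prime. -/
theorem Ideal.exists_mem_nonZeroDivisors_notMem {J I : Ideal R} (hJI : ¬ J ≤ I)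
    (hJ : ∃ a ∈ J, a ∈ nonZeroDivisors R) : ∃ x ∈ J, x ∈ nonZeroDivisors R ∧ x ∉ I := by
  by_contra! h
  have hsub : (J : Set R) ⊆ ⋃ P ∈ insert I (associatedPrimes R R), (P : Set R) := by
    intro y hy
    rw [Set.biUnion_insert, biUnion_associatedPrimes_eq_compl_nonZeroDivisors]
    exact or_iff_not_imp_right.2 fun hn => h y hy (not_not.1 hn)
  obtain ⟨P, hP, hJP⟩ := (Ideal.subset_union_prime_finite
    ((associatedPrimes.finite R R).insert I) (f := id) I I fun P hP hne _ =>
      (hP.resolve_left hne).isPrime).1 hsub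
  obtain rfl | hP := hP
  · exact hJI hJP
  · obtain ⟨a, haJ, ha⟩ := hJ
    have : a ∈ (nonZeroDivisors R : Set R)ᶜ := by
      rw [← biUnion_associatedPrimes_eq_compl_nonZeroDivisors]
      exact Set.mem_biUnion hP (hJP haJ)
    exact this ha

/-- The case of length two of the independence of the grade from the chosen regular sequence: if `J`
contains an `R`-sequence `a, b`, then any nonzerodivisor `x` can be taken as the first member of
such a sequence. -/
theorem Ideal.exists_mem_map_quotient_span_nonZeroDivisors {J : Ideal R} {a b x : R}
    (ha : a ∈ J) (hb : b ∈ J) (hareg : a ∈ nonZeroDivisors R)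
    (hbreg : ∀ r, a ∣ b * r → a ∣ r) (hxreg : x ∈ nonZeroDivisors R) :
    ∃ y ∈ J.map (Ideal.Quotient.mk (Ideal.span {x})),
      y ∈ nonZeroDivisors (R ⧸ Ideal.span {x}) := by
  by_contra! h
  obtain ⟨z, hzJ, hz⟩ := Submodule.exists_mem_ne_zero_of_ne_bot
    (bot_lt_annihilator_of_disjoint_nonZeroDivisors (Set.disjoint_left.2 h)).ne'
  rw [Submodule.mem_annihilator] at hzJ
  obtain ⟨z, rfl⟩ := Ideal.Quotient.mk_surjective z
  have hzJ' : ∀ j ∈ J, x ∣ z * j := fun j hj => by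
    have := hzJ _ (Ideal.mem_map_of_mem _ hj)
    rwa [smul_eq_mul, ← map_mul, Ideal.Quotient.eq_zero_iff_mem, Ideal.mem_span_singleton] at this
  rw [Ne, Ideal.Quotient.eq_zero_iff_mem, Ideal.mem_span_singleton] at hz
  -- If `z ∉ (x)` but `z J ⊆ (x)`, write `z a = x w`. Then `x (w b) = a (z b)` gives `a ∣ w`, and
  -- cancelling `a` yields `x ∣ z`.
  obtain ⟨w, hw⟩ := hzJ' a ha
  obtain ⟨v, hv⟩ := hzJ' b hb
  have hwa : a ∣ w := hbreg w ⟨v, by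
    rw [← mul_cancel_left_mem_nonZeroDivisors hxreg]
    linear_combination a * hv - b * hw⟩
  obtain ⟨w', rfl⟩ := hwa
  refine hz ⟨w', ?_⟩
  rw [← mul_cancel_right_mem_nonZeroDivisors hareg, hw]
  ring

end Grade

/-! ### Nagata's change of rings theorem -/

section Nagata

variable {R : Type u} [CommRing R]

theorem hasProjectiveDimensionLT_one_of_projective (M : Type u) [AddCommGroup M] [Module R M]
    [Module.Projective R M] : HasProjectiveDimensionLT (ModuleCat.of R M) 1 := by
  rw [← projective_iff_hasProjectiveDimensionLT_one, ← IsProjective.iff_projective]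
  infer_instance

/-- The resolution `0 → R^ι → R^ι → (R/x)^ι → 0` by multiplication with `x`. -/
theorem hasProjectiveDimensionLT_two_pi_quotient {x : R}
    (hreg : x ∈ nonZeroDivisors R) (ι : Type u) [Finite ι] :
    HasProjectiveDimensionLT (ModuleCat.of R (ι → R ⧸ Ideal.span {x})) 2 := by
  let f : (ι → R) →ₗ[R] (ι → R ⧸ Ideal.span {x}) :=
    (Submodule.mkQ (Ideal.span {x})).compLeft ι
  have hf : Function.Surjective f := (Submodule.mkQ_surjective _).comp_left
  let T : (ι → R) →ₗ[R] LinearMap.ker f := (LinearMap.lsmul R (ι → R) x).codRestrict _ fun c => by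
    ext i
    exact Ideal.Quotient.eq_zero_iff_mem.2
      (Ideal.mul_mem_right _ _ (Ideal.mem_span_singleton_self x))
  have hT : Function.Bijective T := by
    constructor
    · intro c d h
      ext i
      exact (mul_cancel_left_mem_nonZeroDivisors hreg).1
        (congrFun (congrArg Subtype.val h) i)
    · rintro ⟨c, hc⟩
      have : ∀ i, ∃ d, c i = x * d := fun i =>
        Ideal.mem_span_singleton.1 (Ideal.Quotient.eq_zero_iff_mem.1 (congrFun hc i))
      choose d hd using this
      exact ⟨d, Subtype.ext (funext fun i => (hd i).symm)⟩
  have hker : Module.Projective R (LinearMap.ker f) :=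
    Module.Projective.of_equiv (LinearEquiv.ofBijective T hT)
  have hP : HasProjectiveDimensionLT (ModuleCat.of R (ι → R)) 1 :=
    hasProjectiveDimensionLT_one_of_projective _
  rw [IsProjective.iff_projective, projective_iff_hasProjectiveDimensionLT_one] at hker
  exact (LinearMap.shortExact_shortComplexKer hf).hasProjectiveDimensionLT_X₃ 1 hker
    (hasProjectiveDimensionLT_of_ge _ 1 _ (by simp))

variable [IsLocalRing R]

/-- A finite module over a local ring has a generating family all of whose relations have
coefficients in the maximal ideal. -/
theorem exists_minimal_generators (M : Type u) [AddCommGroup M] [Module R M] [Module.Finite R M] :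
    ∃ (ι : Type u) (_ : Fintype ι) (v : ι → M), Submodule.span R (Set.range v) = ⊤ ∧
      ∀ c : ι → R, ∑ i, c i • v i = 0 → ∀ i, c i ∈ maximalIdeal R := by
  let b := Module.Free.chooseBasis (ResidueField R) (TensorProduct R (ResidueField R) M)
  choose v hv using fun i => TensorProduct.mk_surjective R M (ResidueField R) residue_surjective
    (b i)
  refine ⟨_, inferInstance, v, span_eq_top_of_tmul_eq_basis v b hv, fun c hc i => ?_⟩
  have h := congrArg (TensorProduct.mk R (ResidueField R) M 1) hc
  simp only [map_sum, map_smul, hv, map_zero] at h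
  rw [← residue_eq_zero_iff]
  exact Fintype.linearIndependent_iff.1 b.linearIndependent (fun i => residue R (c i)) h i

variable [IsNoetherianRing R]

/-- An element of `𝔪` outside `𝔪²` is detected by a linear functional on the cotangent space
`𝔪/𝔪²`. -/
theorem exists_linearMap_residueField_eq_one {x : R} (hx : x ∈ maximalIdeal R)
    (hx2 : x ∉ maximalIdeal R ^ 2) :
    ∃ l : maximalIdeal R →ₗ[R] ResidueField R, l ⟨x, hx⟩ = 1 := by
  have hne : ((maximalIdeal R).toCotangent ⟨x, hx⟩ : CotangentSpace R) ≠ 0 := by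
    rwa [Ne, Ideal.toCotangent_eq_zero]
  obtain ⟨f, hf⟩ := Module.Projective.exists_dual_eq_one (ResidueField R) hne
  exact ⟨f.restrictScalars R ∘ₗ (maximalIdeal R).toCotangent, hf⟩

/-- Let `K ⊆ 𝔪 R^ι` be free and contain `x R^ι`, where `x ∈ 𝔪` lies outside `𝔪²`; then `K = x R^ι`.

Let `φ` be the matrix of the inclusion `K → R^ι` and `ψ` that of multiplication by `x` as a map
`R^ι → K`, so that `ψ φ = x`. Choosing a functional `l` on `𝔪/𝔪²` with `l x = 1` and applying it
entrywise turns this into `ψ̄ · l(φ) = 1` over the residue field. Hence `ψ` is surjective modulo `𝔪`,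
and by Nakayama's lemma it is surjective. -/
theorem exists_eq_smul_of_mem_of_smul_mem {ι : Type*} [Finite ι] {x : R}
    (hx : x ∈ maximalIdeal R) (hx2 : x ∉ maximalIdeal R ^ 2) (K : Submodule R (ι → R))
    [Module.Free R K] (hK : ∀ c ∈ K, ∀ i, c i ∈ maximalIdeal R) (hxK : ∀ c, x • c ∈ K)
    {c : ι → R} (hc : c ∈ K) : ∃ d, c = x • d := by
  classical
  have := Fintype.ofFinite ι
  obtain ⟨l, hl⟩ := exists_linearMap_residueField_eq_one hx hx2
  let b := Module.Free.chooseBasis R K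
  let T : (ι → R) →ₗ[R] K := (LinearMap.lsmul R (ι → R) x).codRestrict K hxK
  suffices h : (⊤ : Submodule R K) ≤ LinearMap.range T by
    obtain ⟨d, hd⟩ := h (Submodule.mem_top (x := ⟨c, hc⟩))
    exact ⟨d, (congrArg Subtype.val hd).symm⟩
  refine Submodule.le_of_le_smul_of_le_jacobson_bot (I := maximalIdeal R) Module.Finite.fg_top
    (maximalIdeal_le_jacobson _) ?_
  rw [← b.span_eq, Submodule.span_le]
  rintro _ ⟨j, rfl⟩
  -- The entries of the `j`-th column of `l(φ)`, lifted to `R`.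
  choose g hg using fun i => residue_surjective (l ⟨(b j : ι → R) i, hK _ (b j).2 i⟩)
  have hTb : T (b j) = x • b j := rfl
  have key : ∀ k, b.repr (T g - b j) k ∈ maximalIdeal R := by
    intro k
    -- `ψ` is the `k`-th row of the matrix of `T`.
    obtain ⟨ψ, hψ⟩ : ∃ ψ : ι → R, ∀ c, b.repr (T c) k = ∑ i, c i * ψ i := by
      refine ⟨fun i => b.repr (T (Pi.single i 1)) k, fun c => ?_⟩
      conv_lhs => rw [pi_eq_sum_univ' c]
      simp [Finsupp.finsetSum_apply]
    have h1 := congrArg (fun y => b.repr y k) hTb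
    rw [← residue_eq_zero_iff]
    simp only [hψ, map_smul, Finsupp.smul_apply, smul_eq_mul, Module.Basis.repr_self] at h1
    simp only [map_sub, Finsupp.sub_apply, hψ, map_sum, map_mul, hg, Module.Basis.repr_self]
    -- The `(k, j)` entry of `ψ φ = x`, read in the module `𝔪` so that `l` can be applied.
    have h2 : ∑ i, ψ i • (⟨(b j : ι → R) i, hK _ (b j).2 i⟩ :
        maximalIdeal R) = (Finsupp.single j (1 : R) k) • ⟨x, hx⟩ := by
      ext
      simp only [AddSubmonoidClass.coe_finsetSum, Submodule.coe_smul, smul_eq_mul]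
      simpa [mul_comm] using h1
    have h3 := congrArg l h2
    simp only [map_sum, map_smul, hl, Algebra.smul_def, mul_one] at h3
    rw [sub_eq_zero]
    simpa [mul_comm] using h3
  have h4 : T g - b j ∈ maximalIdeal R • (⊤ : Submodule R K) := by
    rw [← b.sum_repr (T g - b j)]
    exact Submodule.sum_mem _ fun k _ => Submodule.smul_mem_smul (key k) trivial
  rw [b.span_eq, ← sub_sub_cancel (T g) (b j)]
  exact Submodule.sub_mem _ (Submodule.mem_sup_left ⟨g, rfl⟩) (Submodule.mem_sup_right h4)

/-- The case of projective dimension at most one of Nagata's theorem: for a minimal generating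
family, the module of relations over `R` is free, so it consists of the multiples of `x` and becomes
zero over `R/x`. -/
theorem free_quotient_span_singleton_of_hasProjectiveDimensionLT_two {x : R}
    (hx : x ∈ maximalIdeal R) (hx2 : x ∉ maximalIdeal R ^ 2) (M : Type u) [AddCommGroup M]
    [Module R M] [Module (R ⧸ Ideal.span {x}) M] [IsScalarTower R (R ⧸ Ideal.span {x}) M]
    [Module.Finite R M] (h : HasProjectiveDimensionLT (ModuleCat.of R M) 2) :
    Module.Free (R ⧸ Ideal.span {x}) M := by
  obtain ⟨ι, _, v, hspan, hmin⟩ := exists_minimal_generators (R := R) M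
  let f : (ι → R) →ₗ[R] M := Fintype.linearCombination R v
  have hf : Function.Surjective f := by
    rw [← LinearMap.range_eq_top, Fintype.range_linearCombination, hspan]
  have hP : HasProjectiveDimensionLT (ModuleCat.of R (ι → R)) 1 :=
    hasProjectiveDimensionLT_one_of_projective _
  have hker : Module.Projective R (LinearMap.ker f) := by
    rw [IsProjective.iff_projective, projective_iff_hasProjectiveDimensionLT_one]
    exact (LinearMap.shortExact_shortComplexKer hf).hasProjectiveDimensionLT_X₁ 1 hP h
  have : Module.Free R (LinearMap.ker f) := Module.free_of_flat_of_isLocalRing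
  refine Module.Free.of_basis (Module.Basis.mk (v := v) ?_ ?_)
  · rw [Fintype.linearIndependent_iff]
    intro c hc i
    choose c' hc' using fun i => Ideal.Quotient.mk_surjective (c i)
    have hmk : ∀ (r : R) (y : M), (Ideal.Quotient.mk (Ideal.span {x}) r) • y = r • y :=
      fun r y => algebraMap_smul (R ⧸ Ideal.span {x}) r y
    have hker : c' ∈ LinearMap.ker f := by
      rw [LinearMap.mem_ker, ← hc, Fintype.linearCombination_apply]
      exact Finset.sum_congr rfl fun i _ => by rw [← hc', hmk]
    obtain ⟨d, rfl⟩ := exists_eq_smul_of_mem_of_smul_mem hx hx2 (LinearMap.ker f)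
      (fun c hc => hmin c (by simpa [f, Fintype.linearCombination_apply] using hc))
      (fun c => by
        rw [LinearMap.mem_ker, map_smul, ← hmk, Ideal.Quotient.eq_zero_iff_mem.2
          (Ideal.mem_span_singleton_self x), zero_smul]) hker
    rw [← hc', Ideal.Quotient.eq_zero_iff_mem]
    exact Ideal.mul_mem_right _ _ (Ideal.mem_span_singleton_self x)
  · rw [← Submodule.restrictScalars_span R (R ⧸ Ideal.span {x}) Ideal.Quotient.mk_surjective,
      Submodule.restrictScalars_eq_top_iff] at hspan
    exact hspan.ge

/-- Nagata's change of rings theorem: over `R/x`, where `x ∈ 𝔪` is a nonzerodivisor outside `𝔪²`,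
a finite `R/x`-module of projective dimension at most `n + 1` over `R` has projective dimension at
most `n`. -/
theorem hasProjectiveDimensionLT_quotient_span_singleton {x : R} (hx : x ∈ maximalIdeal R)
    (hx2 : x ∉ maximalIdeal R ^ 2) (hreg : x ∈ nonZeroDivisors R) (n : ℕ) (M : Type u)
    [AddCommGroup M] [Module R M] [Module (R ⧸ Ideal.span {x}) M]
    [IsScalarTower R (R ⧸ Ideal.span {x}) M] [Module.Finite R M]
    (h : HasProjectiveDimensionLT (ModuleCat.of R M) (n + 2)) :
    HasProjectiveDimensionLT (ModuleCat.of (R ⧸ Ideal.span {x}) M) (n + 1) := by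
  induction n generalizing M with
  | zero =>
    have := free_quotient_span_singleton_of_hasProjectiveDimensionLT_two hx hx2 M h
    rw [zero_add]
    exact hasProjectiveDimensionLT_one_of_projective M
  | succ n ih =>
    have : Module.Finite (R ⧸ Ideal.span {x}) M := Module.Finite.of_restrictScalars_finite R _ _
    obtain ⟨ι, _, v, hspan⟩ : ∃ (ι : Type u) (_ : Fintype ι) (v : ι → M),
        Submodule.span (R ⧸ Ideal.span {x}) (Set.range v) = ⊤ := by
      obtain ⟨s, hs⟩ := Module.Finite.fg_top (R := R ⧸ Ideal.span {x}) (M := M)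
      exact ⟨s, inferInstance, (↑), by simpa using hs⟩
    let f : (ι → R ⧸ Ideal.span {x}) →ₗ[R ⧸ Ideal.span {x}] M :=
      Fintype.linearCombination _ v
    have hf : Function.Surjective f := by
      rw [← LinearMap.range_eq_top, Fintype.range_linearCombination, hspan]
    -- A syzygy over `R/x` has smaller projective dimension over `R` because free `R/x`-modules have
    -- projective dimension at most one over `R`.
    have hF := hasProjectiveDimensionLT_two_pi_quotient hreg ι
    have hN : HasProjectiveDimensionLT (ModuleCat.of R (LinearMap.ker f)) (n + 2) :=
      (LinearMap.shortExact_shortComplexKer (f := f.restrictScalars R)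
        hf).hasProjectiveDimensionLT_X₁ (n + 2) (hasProjectiveDimensionLT_of_ge _ 2 _ (by simp)) h
    have : Module.Finite R (LinearMap.ker f) :=
      inferInstanceAs (Module.Finite R (LinearMap.ker (f.restrictScalars R)))
    have hP : HasProjectiveDimensionLT
        (ModuleCat.of (R ⧸ Ideal.span {x}) (ι → R ⧸ Ideal.span {x})) 1 :=
      hasProjectiveDimensionLT_one_of_projective _
    exact (LinearMap.shortExact_shortComplexKer hf).hasProjectiveDimensionLT_X₃ (n + 1)
      (ih (LinearMap.ker f) hN) (hasProjectiveDimensionLT_of_ge _ 1 _ (by simp))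

end Nagata

/-! ### Generators of ideals of small projective dimension -/

section Generators

variable {R : Type u} [CommRing R] [IsNoetherianRing R]

theorem Ideal.spanFinrank_le_spanFinrank_map_quotient_span_singleton_add_one {J : Ideal R} {x : R}
    (hx : x ∈ J) :
    J.spanFinrank ≤ (J.map (Ideal.Quotient.mk (Ideal.span {x}))).spanFinrank + 1 := by
  set q := Ideal.Quotient.mk (Ideal.span {x})
  have hfg : (J.map q).FG := (J.fg_of_isNoetherianRing).map q
  have hsec : Function.RightInverse (Function.surjInv (Ideal.Quotient.mk_surjective)) q :=
    Function.rightInverse_surjInv Ideal.Quotient.mk_surjective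
  set s := Function.surjInv (Ideal.Quotient.mk_surjective (I := Ideal.span {x}))
  set G := (J.map q).generators
  have hfin : G.Finite := Submodule.FG.finite_generators hfg
  -- `x` and lifts of the generators of `J/(x)` generate `J`.
  have hJ : J = Ideal.span (insert x (s '' G)) := by
    have hmap : J.map q = (Ideal.span (s '' G)).map q := by
      rw [Ideal.map_span, ← Set.image_comp, hsec.comp_eq_id, Set.image_id]
      exact ((J.map q).span_generators).symm
    have h := congrArg (Ideal.comap q) hmap
    rw [Ideal.comap_map_of_surjective' _ Ideal.Quotient.mk_surjective,
      Ideal.comap_map_of_surjective' _ Ideal.Quotient.mk_surjective, Ideal.mk_ker,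
      sup_eq_left.2 ((Ideal.span_singleton_le_iff_mem J).2 hx)] at h
    rw [Ideal.span_insert, sup_comm, h]
  rw [hJ]
  refine (Submodule.spanFinrank_span_le_ncard_of_finite ((hfin.image s).insert x)).trans
    ((Set.ncard_insert_le _ _).trans (Nat.add_le_add_right ?_ 1))
  rw [← hJ, ← Submodule.FG.generators_ncard hfg]
  exact Set.ncard_image_le hfin

variable [IsLocalRing R]

/-- An ideal `J` with `R/J` of projective dimension at most one is free, and a free ideal has rank at
most one. -/
theorem Ideal.spanFinrank_le_one_of_hasProjectiveDimensionLT_two {J : Ideal R}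
    (h : HasProjectiveDimensionLT (ModuleCat.of R (R ⧸ J)) 2) : J.spanFinrank ≤ 1 := by
  have hP : HasProjectiveDimensionLT (ModuleCat.of R R) 1 :=
    hasProjectiveDimensionLT_one_of_projective _
  have hker : Module.Projective R (LinearMap.ker J.mkQ) := by
    rw [IsProjective.iff_projective, projective_iff_hasProjectiveDimensionLT_one]
    exact (LinearMap.shortExact_shortComplexKer J.mkQ_surjective).hasProjectiveDimensionLT_X₁ 1 hP h
  rw [Submodule.ker_mkQ] at hker
  have : Module.Free R J := Module.free_of_flat_of_isLocalRing
  rw [← Submodule.spanFinrank_top, ← Module.finrank_eq_spanFinrank_of_free]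
  exact (Submodule.finrank_le J).trans_eq (Module.finrank_self R)

theorem Ideal.hasProjectiveDimensionLT_quotient_map {J : Ideal R} {x : R}
    (hxJ : x ∈ J) (hx : x ∈ maximalIdeal R) (hx2 : x ∉ maximalIdeal R ^ 2)
    (hreg : x ∈ nonZeroDivisors R) {n : ℕ}
    (h : HasProjectiveDimensionLT (ModuleCat.of R (R ⧸ J)) (n + 2)) :
    HasProjectiveDimensionLT (ModuleCat.of (R ⧸ Ideal.span {x})
      ((R ⧸ Ideal.span {x}) ⧸ J.map (Ideal.Quotient.mk (Ideal.span {x})))) (n + 1) := by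
  have e : ((R ⧸ Ideal.span {x}) ⧸ J.map (Ideal.Quotient.mk (Ideal.span {x}))) ≃ₗ[R] R ⧸ J :=
    (DoubleQuot.quotQuotEquivQuotOfLEₐ R
      ((Ideal.span_singleton_le_iff_mem J).2 hxJ)).toLinearEquiv
  have := Module.Finite.equiv e.symm
  exact hasProjectiveDimensionLT_quotient_span_singleton hx hx2 hreg n _
    (hasProjectiveDimensionLT_of_iso e.symm.toModuleIso (n + 2))

end Generators

theorem mainTheorem11 {R : Type u} [CommRing R] [IsNoetherianRing R] [IsLocalRing R]
    [IsAdicComplete (IsLocalRing.maximalIdeal R) R]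
    [Infinite (IsLocalRing.ResidueField R)]
    (hdim : 3 ≤ ringKrullDim R)
    (J : Ideal R)
    (hJm : J ≤ IsLocalRing.maximalIdeal R)
    (hperf : J.IsPerfectIdeal)
    (hheight : J.height = 3)
    (hgen : 2 ≤ (J.map (Ideal.Quotient.mk (IsLocalRing.maximalIdeal R ^ 2))).spanFinrank)
    (hJy : ∀ y ∈ IsLocalRing.maximalIdeal R,
      ¬ J ≤ Ideal.span {y} ⊔ IsLocalRing.maximalIdeal R ^ 2) :
    J.spanFinrank ≤ 3 := by
  -- Projective dimension at most one makes `J` principal; otherwise the grade is at least two.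
  by_cases hpd : HasProjectiveDimensionLT (ModuleCat.of R (R ⧸ J)) 2
  · exact (Ideal.spanFinrank_le_one_of_hasProjectiveDimensionLT_two hpd).trans (by norm_num)
  rw [← projectiveDimension_ge_iff, hperf.2] at hpd
  obtain ⟨a, ha, b, hb, hareg, hbreg⟩ :=
    Ideal.exists_pair_of_two_le_rGrade (WithBot.coe_le_coe.1 hpd)
  have hpd4 : HasProjectiveDimensionLT (ModuleCat.of R (R ⧸ J)) (2 + 2) := by
    refine (projectiveDimension_le_iff _ 3).1 ?_
    rw [hperf.2]
    exact WithBot.coe_le_coe.2 (J.rGrade_le_height.trans_eq hheight)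
  obtain ⟨x, hxJ, hxreg, hx2⟩ := Ideal.exists_mem_nonZeroDivisors_notMem
    (I := maximalIdeal R ^ 2) (fun h => hJy 0 (zero_mem _) (h.trans le_sup_right)) ⟨a, ha, hareg⟩
  have hxm := hJm hxJ
  have : Nontrivial (R ⧸ Ideal.span {x}) := Ideal.Quotient.nontrivial_iff.2 fun h =>
    hxm (Ideal.span_singleton_eq_top.1 h)
  have : IsLocalRing (R ⧸ Ideal.span {x}) :=
    .of_surjective' (Ideal.Quotient.mk (Ideal.span {x})) Ideal.Quotient.mk_surjective
  set q := Ideal.Quotient.mk (Ideal.span {x})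
  have hm := map_maximalIdeal_of_surjective q Ideal.Quotient.mk_surjective
  have hpd3 := Ideal.hasProjectiveDimensionLT_quotient_map hxJ hxm hx2 hxreg hpd4
  -- Since `J` is not contained in `(x) + 𝔪²`, its image is not contained in the square.
  have hJ' : ¬ J.map q ≤ maximalIdeal (R ⧸ Ideal.span {x}) ^ 2 := by
    intro h
    refine hJy x hxm fun j hj => ?_
    have hj' := h (Ideal.mem_map_of_mem q hj)
    rw [← hm, ← Ideal.map_pow, Ideal.mem_quotient_iff_mem_sup] at hj'
    rwa [sup_comm]
  obtain ⟨y, hyJ, hyreg, hy2⟩ := Ideal.exists_mem_nonZeroDivisors_notMem hJ'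
    (Ideal.exists_mem_map_quotient_span_nonZeroDivisors ha hb hareg hbreg hxreg)
  have hym : y ∈ maximalIdeal (R ⧸ Ideal.span {x}) :=
    hm.le (Ideal.map_mono hJm hyJ)
  have : Nontrivial ((R ⧸ Ideal.span {x}) ⧸ Ideal.span {y}) :=
    Ideal.Quotient.nontrivial_iff.2 fun h => hym (Ideal.span_singleton_eq_top.1 h)
  have : IsLocalRing ((R ⧸ Ideal.span {x}) ⧸ Ideal.span {y}) :=
    .of_surjective' (Ideal.Quotient.mk (Ideal.span {y})) Ideal.Quotient.mk_surjective
  have hpd2 := Ideal.hasProjectiveDimensionLT_quotient_map hyJ hym hy2 hyreg hpd3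
  have h1 := Ideal.spanFinrank_le_one_of_hasProjectiveDimensionLT_two hpd2
  have h2 := Ideal.spanFinrank_le_spanFinrank_map_quotient_span_singleton_add_one hyJ
  have h3 := Ideal.spanFinrank_le_spanFinrank_map_quotient_span_singleton_add_one hxJ
  lia
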